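/- Let $d\ge 1$ be an integer, let $\lambda_b,\upsilon,\alpha_k,\mu_k,\Omega_k>0$ be real, and put $\delta=d/\upsilon$ and $c_d=\pi^{d/2}/\Gamma(1+d/2)$. Let $X_1,X_2,\dots$ be random points of $\mathbb R^d$ (the legitimate receivers; the transmitter is at the origin) that form a homogeneous Poisson point process of density $\lambda_b$. Let $g_1,g_2,\dots$ be the channel power gains: i.i.d. random variables, independent of $(X_n)_{n\ge1}$, following $\alpha$-$\mu$ fading, that is, with density $$f_{g_k}(x)=\frac{\alpha_k\,x^{\alpha_k\mu_k/2-1}}{2\,\Omega_k^{\alpha_k\mu_k/2}\,\Gamma(\mu_k)}\exp\Bigl(-\Bigl(\frac{x}{\Omega_k}\Bigr)^{\alpha_k/2}\Bigr)\quad(x>0),$$ and $f_{g_k}(x)=0$ for $x\le 0$; for instance with the scale $\Omega_k=\Gamma(\mu_k)/\Gamma(\mu_k+2/\alpha_k)$, for which the gain has mean $1$. Let $r_n=\|X_n\|$. Then the path-loss process with fading, $\Xi_k=\{r_n^{\upsilon}/g_n : n\ge 1\}$ (points counted with multiplicity), is a Poisson point process on $\mathbb R_+=(0,\infty)$ with intensity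 function $$\lambda_{\Xi_k}(x)=A_{b0}\,x^{\delta-1},\qquad A_{b0}=\frac{\lambda_b\,c_d\,\delta\,\Omega_k^{\delta}\,\Gamma\bigl(\mu_k+\frac{2\delta}{\alpha_k}\bigr)}{\Gamma(\mu_k)}.$$ -/

import Mathlib

open MeasureTheory ProbabilityTheory
open scoped ENNReal NNReal

/-- The volume `π^{d/2} / Γ(1 + d/2)` of the unit ball of `ℝ^d`. -/
noncomputable def unitBallVolume (d : ℕ) : ℝ :=
  Real.pi ^ ((d : ℝ) / 2) / Real.Gamma (1 + (d : ℝ) / 2)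

/-- The probability density of the power gain of an `α`-`μ` fading channel with scale `Ω`;
it lives on `(0, ∞)`. -/
noncomputable def alphaMuPDF (α μ Ω : ℝ) (x : ℝ) : ℝ :=
  if 0 < x then
    α * x ^ (α * μ / 2 - 1) / (2 * Ω ^ (α * μ / 2) * Real.Gamma μ)
      * Real.exp (-((x / Ω) ^ (α / 2)))
  else 0

/-- The `α`-`μ` distribution of the power gain, as a measure on `ℝ`. -/
noncomputable def alphaMuMeasure (α μ Ω : ℝ) : Measure ℝ :=
  (volume : Measure ℝ).withDensity (fun x => ENNReal.ofReal (alphaMuPDF α μ Ω x))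

/-- The Poisson distribution on `{0, 1, 2, …, ∞}` with mean `r ∈ [0, ∞]`, seen in `[0, ∞]`;
for `r = ∞` it is the point mass at `∞`. -/
noncomputable def extPoissonLaw (r : ℝ≥0∞) : Measure ℝ≥0∞ :=
  if r = ∞ then Measure.dirac ∞
  else (poissonMeasure r.toNNReal).map (fun n : ℕ => (n : ℝ≥0∞))

/-- The counting measure `∑ₙ δ_{ξₙ}` of the sequence of random points `ξ₀, ξ₁, …`:
`pointProcess ξ ω B` is the number of indices `n` with `ξₙ(ω) ∈ B`. -/
noncomputable def pointProcess {S E : Type*} [MeasurableSpace E] (ξ : ℕ → S → E) (ω : S) :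
    Measure E :=
  Measure.sum (fun n => Measure.dirac (ξ n ω))

/-- `N` is a Poisson point process on `E` with intensity measure `Λ`, under the probability `P`:
a random integer-valued measure whose value on every measurable set `B` is Poisson with mean `Λ B`
and whose values on finitely many pairwise disjoint measurable sets are independent. -/
structure IsPoissonPointProcess {S E : Type*} [MeasurableSpace S] [MeasurableSpace E]
    (N : S → Measure E) (Λ : Measure E) (P : Measure S) : Prop where
  measurable : Measurable N
  integer_valued : ∀ ω, ∀ B, MeasurableSet B → ∃ n : ℕ∞, N ω B = (n : ℝ≥0∞)
  law : ∀ B, MeasurableSet B → P.map (fun ω => N ω B) = extPoissonLaw (Λ B)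
  indep : ∀ (m : ℕ) (B : Fin m → Set E), (∀ i, MeasurableSet (B i)) →
    Pairwise (fun i j => Disjoint (B i) (B j)) → iIndepFun (fun i ω => N ω (B i)) P

/-- The measure on the half-line `(0, ∞)`, as a measure on `ℝ`, with density `f`. -/
noncomputable def halfLineIntensity (f : ℝ → ℝ) : Measure ℝ :=
  ((volume : Measure ℝ).restrict (Set.Ioi 0)).withDensity (fun x => ENNReal.ofReal (f x))

/-- `A = lam c_d δ Ω^δ Γ(μ + 2δ/α) / Γ(μ)`. -/
noncomputable def intensityCoeff (d : ℕ) (lam δ α μ Ω : ℝ) : ℝ :=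
  lam * unitBallVolume d * δ * Ω ^ δ * Real.Gamma (μ + 2 * δ / α) / Real.Gamma μ

/-! A random counting measure `N` is Poisson with intensity `Λ` exactly when `E exp(-∫ f dN) =
exp(-∫ (1 - exp(-f)) dΛ)` for all measurable `f ≥ 0`. Both directions are proved, with `f` and the
counts valued in `[0, ∞]`, so that no integrability or local finiteness is needed
(`IsPoissonPointProcess.hasPoissonLaplace`, `HasPoissonLaplace.isPoisson`).

Averaging over independent marks turns `f` into a function of the location alone, which gives the
marking theorem with intensity `Λ ⊗ ν`; mapping is a change of variables. The path losses are thus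
Poisson with the image intensity. Its mass on `(-∞, t]` comes from slicing by the gain `y`: the
slice is a ball of volume `c_d (t y)^δ`, so the mass is `lam c_d t^δ E[g^δ]`, and the moment is a
Gamma integral (`lintegral_rpow_alphaMuMeasure`). -/

/-- The decreasing exponential `t ↦ exp (-t)` from `[0, ∞]` onto `[0, 1]`. -/
noncomputable def expNeg (t : ℝ≥0∞) : ℝ≥0∞ := EReal.exp (-(t : EReal))

/-- The inverse `s ↦ -log s` of `expNeg` on `[0, 1]`. -/
noncomputable def negLog (s : ℝ≥0∞) : ℝ≥0∞ := (-ENNReal.log s).toENNReal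

@[simp] lemma expNeg_zero : expNeg 0 = 1 := by simp [expNeg]

@[simp] lemma expNeg_top : expNeg ∞ = 0 := by simp [expNeg]

lemma expNeg_add (a b : ℝ≥0∞) : expNeg (a + b) = expNeg a * expNeg b := by
  rw [expNeg, expNeg, expNeg, ← EReal.exp_add, EReal.coe_ennreal_add, EReal.neg_add]
  · rfl
  · left; simp
  · right; simp

lemma expNeg_sum {ι : Type*} (s : Finset ι) (f : ι → ℝ≥0∞) :
    expNeg (∑ i ∈ s, f i) = ∏ i ∈ s, expNeg (f i) := by
  classical
  induction s using Finset.induction_on with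
  | empty => simp
  | insert a s ha ih => rw [Finset.sum_insert ha, Finset.prod_insert ha, expNeg_add, ih]

lemma expNeg_nsmul (n : ℕ) (c : ℝ≥0∞) : expNeg (n • c) = expNeg c ^ n := by
  simpa using expNeg_sum (Finset.range n) fun _ => c

lemma continuous_expNeg : Continuous expNeg :=
  ENNReal.continuous_exp.comp (continuous_neg.comp continuous_coe_ennreal_ereal)

lemma measurable_expNeg : Measurable expNeg := continuous_expNeg.measurable

lemma expNeg_injective : Function.Injective expNeg := fun a b h => by
  simpa using EReal.exp_strictMono.injective h

lemma antitone_expNeg : Antitone expNeg := fun a b h =>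
  EReal.exp_monotone (EReal.neg_le_neg_iff.2 (by exact_mod_cast h))

lemma expNeg_le_one (t : ℝ≥0∞) : expNeg t ≤ 1 := by
  simp [expNeg, EReal.coe_ennreal_nonneg]

lemma expNeg_ne_top (t : ℝ≥0∞) : expNeg t ≠ ∞ :=
  ((expNeg_le_one t).trans_lt ENNReal.one_lt_top).ne

lemma expNeg_coe (r : ℝ≥0) : expNeg r = ENNReal.ofReal (Real.exp (-r)) := by
  have : (-((r : ℝ≥0∞) : EReal)) = ((-r : ℝ) : EReal) := by
    rw [EReal.coe_neg]; rfl
  rw [expNeg, this, EReal.exp_coe]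

lemma measurable_negLog : Measurable negLog := by
  unfold negLog
  fun_prop

lemma expNeg_negLog {s : ℝ≥0∞} (hs : s ≤ 1) : expNeg (negLog s) = s := by
  rw [expNeg, negLog, EReal.coe_toENNReal, neg_neg, ENNReal.exp_log]
  rw [EReal.neg_nonneg]
  exact ENNReal.log_le_zero_iff.2 hs

/-! ### Laplace transforms of laws on `[0, ∞]` -/

lemma lintegral_expNeg_poissonMeasure (r : ℝ≥0) (c : ℝ≥0∞) :
    ∫⁻ n : ℕ, expNeg (c * n) ∂(poissonMeasure r) = expNeg ((1 - expNeg c) * r) := by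
  lift expNeg c to ℝ≥0 using expNeg_ne_top c with s hs
  have hs1 : s ≤ 1 := by exact_mod_cast hs ▸ expNeg_le_one c
  have h1 : (1 - (s : ℝ≥0∞)) * r = (((1 - s) * r : ℝ≥0) : ℝ≥0∞) := by
    push_cast; rfl
  rw [h1, expNeg_coe, lintegral_countable']
  have h2 (n : ℕ) : expNeg (c * n) * poissonMeasure r {n} =
      ENNReal.ofReal (Real.exp (-r) * ((r * s : ℝ) ^ n / n.factorial)) := by
    rw [mul_comm c, ← nsmul_eq_mul, expNeg_nsmul, ← hs, poissonMeasure_singleton,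
      ← ENNReal.ofReal_coe_nnreal, ← ENNReal.ofReal_pow (by positivity),
      ← ENNReal.ofReal_mul (by positivity)]
    congr 1
    ring
  have h3 : HasSum (fun n : ℕ => (r * s : ℝ) ^ n / n.factorial) (Real.exp (r * s)) := by
    rw [Real.exp_eq_exp_ℝ]
    exact NormedSpace.expSeries_div_hasSum_exp _
  simp_rw [h2]
  rw [← ENNReal.ofReal_tsum_of_nonneg (fun n => by positivity) (h3.mul_left _).summable,
    (h3.mul_left _).tsum_eq, ← Real.exp_add]
  congr 2
  push_cast [hs1]
  ring

lemma lintegral_expNeg_extPoissonLaw (r c : ℝ≥0∞) :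
    ∫⁻ t, expNeg (c * t) ∂(extPoissonLaw r) = expNeg ((1 - expNeg c) * r) := by
  unfold extPoissonLaw
  have hm : Measurable fun t => expNeg (c * t) :=
    measurable_expNeg.comp (measurable_const.mul measurable_id)
  split_ifs with h
  · rw [lintegral_dirac' _ hm, h]
    -- At `c = 0` the convention `0 * ∞ = 0` makes both sides `1`; otherwise both are `0`.
    rcases eq_or_ne c 0 with rfl | hc
    · simp
    · have : 1 - expNeg c ≠ 0 := by
        refine (tsub_pos_of_lt (lt_of_le_of_ne (expNeg_le_one c) fun h => hc ?_)).ne'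
        exact expNeg_injective (by simpa using h)
      simp [ENNReal.mul_top hc, ENNReal.mul_top this]
  · rw [lintegral_map hm (by fun_prop), lintegral_expNeg_poissonMeasure, ENNReal.coe_toNNReal h]

instance isProbabilityMeasure_extPoissonLaw (r : ℝ≥0∞) :
    IsProbabilityMeasure (extPoissonLaw r) := by
  unfold extPoissonLaw
  split_ifs
  · infer_instance
  · exact Measure.isProbabilityMeasure_map (by fun_prop)

/-- A finite measure on `[0, ∞]^ι` is determined by its Laplace transform at the points of `ℕ^ι`. -/
lemma Measure.ext_of_lintegral_expNeg {ι : Type*} [Fintype ι] {μ ν : Measure (ι → ℝ≥0∞)}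
    [IsFiniteMeasure μ] [IsFiniteMeasure ν]
    (h : ∀ k : ι → ℕ, ∫⁻ x, expNeg (∑ i, (k i : ℝ≥0∞) * x i) ∂μ =
      ∫⁻ x, expNeg (∑ i, (k i : ℝ≥0∞) * x i) ∂ν) : μ = ν := by
  -- Stone–Weierstrass: polynomials in the functions `exp(-x i)` separate points, and the monomial
  -- with exponent `k` integrates to the Laplace transform at `k`.
  let φ (i : ι) : BoundedContinuousFunction (ι → ℝ≥0∞) ℝ :=
    BoundedContinuousFunction.mkOfCompact ⟨fun x => (expNeg (x i)).toReal, by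
      refine continuous_iff_continuousAt.2 fun x => ?_
      exact (ENNReal.continuousAt_toReal (expNeg_ne_top _)).comp
        (f := fun x : ι → ℝ≥0∞ => expNeg (x i))
        (continuous_expNeg.comp (continuous_apply (A := fun _ : ι => ℝ≥0∞) i)).continuousAt⟩
  let Φ := MvPolynomial.aeval (R := ℝ) φ
  let A : StarSubalgebra ℝ (BoundedContinuousFunction (ι → ℝ≥0∞) ℝ) :=
    { Φ.range with
      star_mem' := fun {a} ha => by
        rwa [show star a = a from by ext x; simp] }
  refine ext_of_forall_mem_subalgebra_integral_eq_of_polish (𝕜 := ℝ) (A := A) ?_ ?_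
  · intro x y hxy
    obtain ⟨i, hi⟩ := Function.ne_iff.1 hxy
    refine ⟨_, ⟨_, ⟨φ i, ⟨MvPolynomial.X i, by simp [Φ]⟩, rfl⟩, rfl⟩, fun he => hi ?_⟩
    exact expNeg_injective <|
      (ENNReal.toReal_eq_toReal_iff' (expNeg_ne_top _) (expNeg_ne_top _)).1 he
  · rintro _ ⟨p, rfl⟩
    change ∫ x, Φ p x ∂μ = ∫ x, Φ p x ∂ν
    induction p using MvPolynomial.induction_on' with
    | add p q hp hq =>
      simp only [map_add, BoundedContinuousFunction.coe_add, Pi.add_apply]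
      rw [integral_add ((Φ p).integrable _) ((Φ q).integrable _),
        integral_add ((Φ p).integrable _) ((Φ q).integrable _), hp, hq]
    | monomial k a =>
      have key (x : ι → ℝ≥0∞) : Φ (MvPolynomial.monomial k a) x =
          a * (expNeg (∑ i, (k i : ℝ≥0∞) * x i)).toReal := by
        rw [expNeg_sum, ENNReal.toReal_prod]
        simp only [Φ, MvPolynomial.aeval_monomial]
        rw [Finsupp.prod_fintype _ _ (by simp)]
        simp [φ, ← nsmul_eq_mul, expNeg_nsmul]
      have hm : AEMeasurable (fun x : ι → ℝ≥0∞ => expNeg (∑ i, (k i : ℝ≥0∞) * x i)) μ :=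
        (measurable_expNeg.comp (by fun_prop)).aemeasurable
      have hm' : AEMeasurable (fun x : ι → ℝ≥0∞ => expNeg (∑ i, (k i : ℝ≥0∞) * x i)) ν :=
        (measurable_expNeg.comp (by fun_prop)).aemeasurable
      simp_rw [key]
      rw [integral_const_mul, integral_const_mul,
        integral_toReal hm (ae_of_all _ fun x => (expNeg_ne_top _).lt_top),
        integral_toReal hm' (ae_of_all _ fun x => (expNeg_ne_top _).lt_top), h]

/-! ### Laplace functionals of Poisson processes -/

lemma tendsto_lintegral_expNeg {S : Type*} [MeasurableSpace S] {P : Measure S} [IsFiniteMeasure P]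
    {F : ℕ → S → ℝ≥0∞} {G : S → ℝ≥0∞} (hF : ∀ n, Measurable (F n))
    (h : ∀ ω, Filter.Tendsto (fun n => F n ω) Filter.atTop (nhds (G ω))) :
    Filter.Tendsto (fun n => ∫⁻ ω, expNeg (F n ω) ∂P) Filter.atTop
      (nhds (∫⁻ ω, expNeg (G ω) ∂P)) := by
  refine tendsto_lintegral_of_dominated_convergence (fun _ => 1)
    (fun n => measurable_expNeg.comp (hF n)) (fun n => ae_of_all _ fun ω => expNeg_le_one _)
    (by simp) (ae_of_all _ fun ω => ?_)
  exact (continuous_expNeg.tendsto _).comp (h ω)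

/-- The Laplace functional of the random measure `N` under `P` is that of a Poisson point process
with intensity measure `Λ`. -/
def HasPoissonLaplace {S E : Type*} [MeasurableSpace S] [MeasurableSpace E]
    (N : S → Measure E) (Λ : Measure E) (P : Measure S) : Prop :=
  ∀ f : E → ℝ≥0∞, Measurable f →
    ∫⁻ ω, expNeg (∫⁻ x, f x ∂(N ω)) ∂P = expNeg (∫⁻ x, (1 - expNeg (f x)) ∂Λ)

section Laplace

variable {S E : Type*} [MeasurableSpace S] [MeasurableSpace E]
  {N : S → Measure E} {Λ : Measure E} {P : Measure S}

/-- The fibres of `f` are disjoint, so their counts are independent and the expectation factors into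
one-dimensional Poisson transforms. -/
lemma IsPoissonPointProcess.lintegral_expNeg_simpleFunc (h : IsPoissonPointProcess N Λ P)
    (f : SimpleFunc E ℝ≥0∞) :
    ∫⁻ ω, expNeg (∫⁻ x, f x ∂(N ω)) ∂P = expNeg (∫⁻ x, (1 - expNeg (f x)) ∂Λ) := by
  let e := f.range.equivFin.symm
  have hms (i) : MeasurableSet (f ⁻¹' {(e i : ℝ≥0∞)}) := f.measurableSet_fiber _
  have hN (i) : Measurable fun ω => N ω (f ⁻¹' {(e i : ℝ≥0∞)}) :=
    (Measure.measurable_coe (hms i)).comp h.measurable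
  have hd : Pairwise fun i j => Disjoint (f ⁻¹' {(e i : ℝ≥0∞)}) (f ⁻¹' {(e j : ℝ≥0∞)}) :=
    fun i j hij => Disjoint.preimage _ <| by
      simpa [Subtype.coe_inj] using hij
  have hsum (g : ℝ≥0∞ → ℝ≥0∞) : ∑ y ∈ f.range, g y = ∑ i, g (e i) := by
    rw [← Finset.sum_coe_sort, ← e.sum_comp]
  have hind := (h.indep _ _ hms hd).comp (fun i t => expNeg ((e i : ℝ≥0∞) * t))
    fun i => measurable_expNeg.comp (by fun_prop)
  have hR : ∫⁻ x, (1 - expNeg (f x)) ∂Λ =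
      ∑ i, (1 - expNeg (e i)) * Λ (f ⁻¹' {(e i : ℝ≥0∞)}) := by
    rw [← hsum fun y => (1 - expNeg y) * Λ (f ⁻¹' {y}), ← SimpleFunc.map_lintegral,
      ← SimpleFunc.lintegral_eq_lintegral]
    rfl
  have hL (ω) : ∫⁻ x, f x ∂(N ω) = ∑ i, (e i : ℝ≥0∞) * N ω (f ⁻¹' {(e i : ℝ≥0∞)}) := by
    rw [SimpleFunc.lintegral_eq_lintegral, SimpleFunc.lintegral,
      hsum fun y => y * N ω (f ⁻¹' {y})]
  simp_rw [hR, hL, expNeg_sum]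
  refine (lintegral_prod_eq_prod_lintegral_of_indepFun Finset.univ _ hind fun i =>
    measurable_expNeg.comp (measurable_const.mul (hN i))).trans
    (Finset.prod_congr rfl fun i _ => ?_)
  have hm : Measurable fun t => expNeg ((e i : ℝ≥0∞) * t) :=
    measurable_expNeg.comp (by fun_prop)
  rw [← lintegral_expNeg_extPoissonLaw, ← h.law _ (hms i), lintegral_map hm (hN i)]
  rfl

lemma IsPoissonPointProcess.hasPoissonLaplace [IsFiniteMeasure P]
    (h : IsPoissonPointProcess N Λ P) : HasPoissonLaplace N Λ P := by
  intro f hf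
  have hlim (M : Measure E) : Filter.Tendsto (fun n => ∫⁻ x, SimpleFunc.eapprox f n x ∂M)
      Filter.atTop (nhds (∫⁻ x, f x ∂M)) :=
    lintegral_tendsto_of_tendsto_of_monotone (fun n => (SimpleFunc.measurable _).aemeasurable)
      (ae_of_all _ fun x m n hmn => SimpleFunc.monotone_eapprox f hmn x)
      (ae_of_all _ fun x => SimpleFunc.tendsto_eapprox hf x)
  -- The left side passes to the limit by dominated convergence, the exponent on the right by
  -- monotone convergence.
  have h1 := tendsto_lintegral_expNeg (P := P) (fun n =>
    (Measure.measurable_lintegral (SimpleFunc.eapprox f n).measurable).comp h.measurable)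
    fun ω => hlim (N ω)
  have h2 : Filter.Tendsto (fun n => ∫⁻ x, (1 - expNeg (SimpleFunc.eapprox f n x)) ∂Λ)
      Filter.atTop (nhds (∫⁻ x, (1 - expNeg (f x)) ∂Λ)) := by
    refine lintegral_tendsto_of_tendsto_of_monotone (fun n => ?_) (ae_of_all _ fun x m n hmn => ?_)
      (ae_of_all _ fun x => ?_)
    · exact (measurable_const.sub (measurable_expNeg.comp (SimpleFunc.measurable _))).aemeasurable
    · exact tsub_le_tsub_left (antitone_expNeg (SimpleFunc.monotone_eapprox f hmn x)) _
    · exact ENNReal.Tendsto.sub tendsto_const_nhds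
        ((continuous_expNeg.tendsto _).comp (SimpleFunc.tendsto_eapprox hf x)) (by simp)
  have h3 := (continuous_expNeg.tendsto _).comp h2
  refine tendsto_nhds_unique h1 (h3.congr fun n => ?_)
  exact (h.lintegral_expNeg_simpleFunc _).symm

lemma lintegral_sum_smul_indicator {m : ℕ} {B : Fin m → Set E} (hB : ∀ i, MeasurableSet (B i))
    (c : Fin m → ℝ≥0∞) (M : Measure E) :
    ∫⁻ x, ∑ i, (B i).indicator (fun _ => c i) x ∂M = ∑ i, c i * M (B i) := by
  rw [lintegral_finsetSum _ fun i _ => measurable_const.indicator (hB i)]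
  simp [lintegral_indicator, hB]

lemma one_sub_expNeg_sum_indicator {E : Type*} {m : ℕ} {B : Fin m → Set E}
    (hd : Pairwise fun i j => Disjoint (B i) (B j)) (c : Fin m → ℝ≥0∞) (x : E) :
    1 - expNeg (∑ i, (B i).indicator (fun _ => c i) x) =
      ∑ i, (B i).indicator (fun _ => 1 - expNeg (c i)) x := by
  by_cases hx : ∃ i, x ∈ B i
  · obtain ⟨i, hi⟩ := hx
    have hj (j) (hj : j ≠ i) : x ∉ B j := Set.disjoint_right.1 (hd hj) hi
    rw [Finset.sum_eq_single i, Finset.sum_eq_single i] <;> simp +contextual [hi, hj]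
  · push Not at hx
    simp [hx]

/-- A random measure whose Laplace functional is Poisson has independent Poisson values on
disjoint sets. -/
lemma HasPoissonLaplace.map_eq_pi [IsProbabilityMeasure P] (hN : Measurable N)
    (h : HasPoissonLaplace N Λ P) {m : ℕ} {B : Fin m → Set E} (hB : ∀ i, MeasurableSet (B i))
    (hd : Pairwise fun i j => Disjoint (B i) (B j)) :
    P.map (fun ω i => N ω (B i)) = Measure.pi fun i => extPoissonLaw (Λ (B i)) := by
  have hm : Measurable fun ω i => N ω (B i) :=
    measurable_pi_lambda _ fun i => (Measure.measurable_coe (hB i)).comp hN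
  have := Measure.isProbabilityMeasure_map (μ := P) hm.aemeasurable
  refine Measure.ext_of_lintegral_expNeg fun k => ?_
  have hk : Measurable fun x : Fin m → ℝ≥0∞ => expNeg (∑ i, (k i : ℝ≥0∞) * x i) :=
    measurable_expNeg.comp (by fun_prop)
  rw [lintegral_map hk hm]
  -- Testing against this step function yields the joint Laplace transform of the counts at `k`.
  have h1 := h (fun x => ∑ i, (B i).indicator (fun _ => (k i : ℝ≥0∞)) x)
    (Finset.measurable_fun_sum _ fun i _ => measurable_const.indicator (hB i))
  simp_rw [one_sub_expNeg_sum_indicator hd, lintegral_sum_smul_indicator hB] at h1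
  rw [h1]
  simp_rw [expNeg_sum]
  have hki (i) : Measurable fun t : ℝ≥0∞ => expNeg ((k i : ℝ≥0∞) * t) :=
    measurable_expNeg.comp (by fun_prop)
  symm
  refine (lintegral_prod_eq_prod_lintegral_of_indepFun Finset.univ _
    (iIndepFun_pi (μ := fun i => extPoissonLaw (Λ (B i))) fun i => (hki i).aemeasurable)
    fun i => (hki i).comp (measurable_pi_apply i)).trans (Finset.prod_congr rfl fun i _ => ?_)
  rw [← lintegral_expNeg_extPoissonLaw,
    (measurePreserving_eval (fun i => extPoissonLaw (Λ (B i))) i).lintegral_comp (hki i)]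

lemma HasPoissonLaplace.isPoisson [IsProbabilityMeasure P] (hN : Measurable N)
    (hint : ∀ ω, ∀ B, MeasurableSet B → ∃ n : ℕ∞, N ω B = (n : ℝ≥0∞))
    (h : HasPoissonLaplace N Λ P) : IsPoissonPointProcess N Λ P := by
  have hlaw (B) (hB : MeasurableSet B) : P.map (fun ω => N ω B) = extPoissonLaw (Λ B) := by
    have h1 := congrArg (Measure.map fun x : Fin 1 → ℝ≥0∞ => x 0) <|
      h.map_eq_pi hN (B := fun _ : Fin 1 => B) (fun _ => hB) fun i j hij =>
        (hij (Subsingleton.elim i j)).elim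
    have hm : Measurable fun ω (_ : Fin 1) => N ω B :=
      measurable_pi_lambda _ fun _ => (Measure.measurable_coe hB).comp hN
    rw [Measure.map_map (measurable_pi_apply 0) hm] at h1
    exact h1.trans (measurePreserving_eval _ 0).map_eq
  refine ⟨hN, hint, hlaw, fun m B hB hd => ?_⟩
  have hm (i) : Measurable fun ω => N ω (B i) := (Measure.measurable_coe (hB i)).comp hN
  rw [iIndepFun_iff_map_fun_eq_pi_map fun i => (hm i).aemeasurable, h.map_eq_pi hN hB hd]
  congr 1
  funext i
  exact (hlaw _ (hB i)).symm

end Laplace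

/-! ### Marking and mapping -/

section Marking

variable {S E G : Type*} [MeasurableSpace S] [MeasurableSpace E] [MeasurableSpace G]

lemma measurable_pointProcess {ξ : ℕ → S → E} (hξ : ∀ n, Measurable (ξ n)) :
    Measurable (pointProcess ξ) := by
  refine Measure.measurable_of_measurable_coe _ fun B hB => ?_
  simp_rw [pointProcess, Measure.sum_apply _ hB, Measure.dirac_apply' _ hB]
  exact Measurable.tsum fun n => (measurable_one.indicator hB).comp (hξ n)

lemma pointProcess_apply_eq_coe {S E : Type*} [MeasurableSpace E] (ξ : ℕ → S → E) (ω : S)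
    {B : Set E} (hB : MeasurableSet B) :
    ∃ n : ℕ∞, pointProcess ξ ω B = (n : ℝ≥0∞) := by
  refine ⟨Set.encard {n | ξ n ω ∈ B}, ?_⟩
  rw [← ENNReal.tsum_set_one, tsum_subtype _ fun _ => (1 : ℝ≥0∞), pointProcess,
    Measure.sum_apply _ hB]
  refine tsum_congr fun n => ?_
  rw [Measure.dirac_apply' _ hB]
  rfl

lemma lintegral_pointProcess {S E : Type*} [MeasurableSpace E] (ξ : ℕ → S → E) (ω : S)
    {f : E → ℝ≥0∞} (hf : Measurable f) :
    ∫⁻ x, f x ∂(pointProcess ξ ω) = ∑' n, f (ξ n ω) := by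
  simp [pointProcess, lintegral_sum_measure, lintegral_dirac' _ hf]

lemma ProbabilityTheory.IndepFun.lintegral_eq_lintegral_lintegral {P : Measure S}
    [IsFiniteMeasure P] {X : S → E} {Y : S → G} (h : IndepFun X Y P) (hX : Measurable X)
    (hY : Measurable Y) {Ψ : E × G → ℝ≥0∞} (hΨ : Measurable Ψ) :
    ∫⁻ ω, Ψ (X ω, Y ω) ∂P = ∫⁻ ω, ∫⁻ ω', Ψ (X ω, Y ω') ∂P ∂P := by
  rw [← lintegral_map hΨ (hX.prodMk hY),
    (indepFun_iff_map_prod_eq_prod_map_map hX.aemeasurable hY.aemeasurable).1 h,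
    lintegral_prod _ hΨ.aemeasurable, lintegral_map hΨ.lintegral_prod_right' hX]
  refine lintegral_congr fun ω => ?_
  exact lintegral_map (hΨ.comp measurable_prodMk_left) hY

/-- Marking theorem, in terms of Laplace functionals: attaching independent marks of law `ν` to the
points of a Poisson point process. -/
lemma HasPoissonLaplace.marked {P : Measure S} [IsProbabilityMeasure P] {Λ : Measure E}
    {ν : Measure G} [IsProbabilityMeasure ν] {X : ℕ → S → E} (hX : ∀ n, Measurable (X n))
    (h : HasPoissonLaplace (pointProcess X) Λ P) {g : ℕ → S → G} (hg : ∀ n, Measurable (g n))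
    (hg_law : ∀ n, P.map (g n) = ν) (hg_indep : iIndepFun g P)
    (hXg : IndepFun (fun ω n => X n ω) (fun ω n => g n ω) P) :
    HasPoissonLaplace (pointProcess fun n ω => (X n ω, g n ω)) (Λ.prod ν) P := by
  intro f hf
  have hef : Measurable fun z => expNeg (f z) := measurable_expNeg.comp hf
  have hef' : Measurable fun z => 1 - expNeg (f z) := measurable_const.sub hef
  have hle (x : E) : ∫⁻ y, expNeg (f (x, y)) ∂ν ≤ 1 :=
    (lintegral_mono fun y => expNeg_le_one _).trans (by simp)
  -- Chosen so that `exp(-F x)` is the average of `exp(-f(x, y))` over the mark `y`.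
  let F (x : E) : ℝ≥0∞ := negLog (∫⁻ y, expNeg (f (x, y)) ∂ν)
  have hF : Measurable F := measurable_negLog.comp hef.lintegral_prod_right'
  -- With the locations frozen, independence of the marks factors each finite product; `M → ∞` comes
  -- afterwards.
  have hpart (M : ℕ) :
      ∫⁻ ω, expNeg (∑ n ∈ Finset.range M, f (X n ω, g n ω)) ∂P =
        ∫⁻ ω, expNeg (∑ n ∈ Finset.range M, F (X n ω)) ∂P := by
    have hΨ : Measurable fun p : (ℕ → E) × (ℕ → G) =>
        expNeg (∑ n ∈ Finset.range M, f (p.1 n, p.2 n)) :=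
      measurable_expNeg.comp (Finset.measurable_fun_sum _ fun n _ => hf.comp (by fun_prop))
    rw [hXg.lintegral_eq_lintegral_lintegral (measurable_pi_lambda _ hX)
      (measurable_pi_lambda _ hg) hΨ]
    refine lintegral_congr fun ω => ?_
    simp_rw [expNeg_sum]
    have hmf (n : ℕ) : Measurable fun y => expNeg (f (X n ω, y)) :=
      hef.comp measurable_prodMk_left
    refine (lintegral_prod_eq_prod_lintegral_of_indepFun (Finset.range M) _
      (hg_indep.comp (fun n y => expNeg (f (X n ω, y))) hmf)
      fun n => (hmf n).comp (hg n)).trans (Finset.prod_congr rfl fun n _ => ?_)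
    rw [expNeg_negLog (hle _), ← hg_law n, lintegral_map (hmf n) (hg n)]
    rfl
  have h1 := tendsto_lintegral_expNeg (P := P) (fun M : ℕ =>
    Finset.measurable_fun_sum (Finset.range M) fun n _ => hf.comp ((hX n).prodMk (hg n)))
    fun ω => ENNReal.tendsto_nat_tsum fun n => f (X n ω, g n ω)
  have h2 := tendsto_lintegral_expNeg (P := P) (fun M : ℕ =>
    Finset.measurable_fun_sum (Finset.range M) fun n _ => hF.comp (hX n))
    fun ω => ENNReal.tendsto_nat_tsum fun n => F (X n ω)
  simp_rw [Function.comp_apply, hpart] at h1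
  have h3 := h F hF
  simp_rw [lintegral_pointProcess _ _ hF] at h3
  simp_rw [lintegral_pointProcess _ _ hf]
  rw [tendsto_nhds_unique h1 h2, h3, 
    lintegral_prod _ hef'.aemeasurable]
  congr 1
  refine lintegral_congr fun x => ?_
  have hx : Measurable fun y => expNeg (f (x, y)) := hef.comp measurable_prodMk_left
  rw [expNeg_negLog (hle x), lintegral_sub hx
    ((hle x).trans_lt ENNReal.one_lt_top).ne (ae_of_all _ fun y => expNeg_le_one _)]
  simp

lemma HasPoissonLaplace.map {P : Measure S} {Λ : Measure E} {ξ : ℕ → S → E}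
    (h : HasPoissonLaplace (pointProcess ξ) Λ P) {φ : E → G} (hφ : Measurable φ) :
    HasPoissonLaplace (pointProcess fun n ω => φ (ξ n ω)) (Λ.map φ) P := by
  intro f hf
  have := h (fun x => f (φ x)) (hf.comp hφ)
  have hfφ : Measurable fun x => f (φ x) := hf.comp hφ
  simp_rw [lintegral_pointProcess _ _ hfφ] at this
  simp_rw [lintegral_pointProcess _ _ hf]
  have hm : Measurable fun y => 1 - expNeg (f y) :=
    measurable_const.sub (measurable_expNeg.comp hf)
  rwa [lintegral_map hm hφ]

/-- Marking and mapping theorem for Poisson point processes. -/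
theorem IsPoissonPointProcess.marked_map {E' : Type*} [MeasurableSpace E'] {P : Measure S}
    [IsProbabilityMeasure P] {Λ : Measure E} {ν : Measure G} [IsProbabilityMeasure ν]
    {X : ℕ → S → E} (hX : ∀ n, Measurable (X n))
    (h : IsPoissonPointProcess (pointProcess X) Λ P) {g : ℕ → S → G} (hg : ∀ n, Measurable (g n))
    (hg_law : ∀ n, P.map (g n) = ν) (hg_indep : iIndepFun g P)
    (hXg : IndepFun (fun ω n => X n ω) (fun ω n => g n ω) P) {φ : E × G → E'}
    (hφ : Measurable φ) :
    IsPoissonPointProcess (pointProcess fun n ω => φ (X n ω, g n ω)) ((Λ.prod ν).map φ) P :=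
  ((h.hasPoissonLaplace.marked hX hg hg_law hg_indep hXg).map hφ).isPoisson
    (measurable_pointProcess fun n => hφ.comp ((hX n).prodMk (hg n)))
    fun ω _ hB => pointProcess_apply_eq_coe _ ω hB

end Marking

/-! ### Moments of the `α`-`μ` distribution -/

lemma ae_pos_alphaMuMeasure (α μ Ω : ℝ) : ∀ᵐ y ∂(alphaMuMeasure α μ Ω), 0 < y := by
  rw [ae_iff, alphaMuMeasure]
  have hs : MeasurableSet {y : ℝ | ¬0 < y} := measurableSet_Ioi.compl
  rw [withDensity_apply _ hs, setLIntegral_congr_fun hs (g := fun _ => 0)]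
  · simp
  · intro y hy
    simp [alphaMuPDF, show ¬0 < y from hy]

lemma measurable_alphaMuPDF (α μ Ω : ℝ) : Measurable (alphaMuPDF α μ Ω) := by
  unfold alphaMuPDF
  exact Measurable.ite measurableSet_Ioi (by fun_prop) measurable_const

lemma alphaMuPDF_mul_rpow {α μ Ω y : ℝ} (hΩ : 0 < Ω) (δ : ℝ) (hy : 0 < y) :
    alphaMuPDF α μ Ω y * y ^ δ = α / (2 * Ω ^ (α * μ / 2) * Real.Gamma μ) *
      (y ^ (δ + α * μ / 2 - 1) * Real.exp (-Ω ^ (-(α / 2)) * y ^ (α / 2))) := by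
  rw [alphaMuPDF, if_pos hy, Real.div_rpow hy.le hΩ.le, Real.rpow_neg hΩ.le,
    add_sub_assoc, Real.rpow_add hy]
  rw [show -(y ^ (α / 2) / Ω ^ (α / 2)) = -(Ω ^ (α / 2))⁻¹ * y ^ (α / 2) by
    rw [div_eq_mul_inv]; ring]
  ring

/-- The `δ`-th moment of the `α`-`μ` distribution. -/
lemma lintegral_rpow_alphaMuMeasure {α μ Ω δ : ℝ} (hα : 0 < α) (hμ : 0 < μ) (hΩ : 0 < Ω)
    (hδ : 0 < δ) :
    ∫⁻ y, ENNReal.ofReal (y ^ δ) ∂(alphaMuMeasure α μ Ω) =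
      ENNReal.ofReal (Ω ^ δ * Real.Gamma (μ + 2 * δ / α) / Real.Gamma μ) := by
  have hΓ := Real.Gamma_pos_of_pos hμ
  have hp : 0 < α / 2 := by positivity
  have hq : -1 < δ + α * μ / 2 - 1 := by
    have : 0 < α * μ := by positivity
    linarith
  have hb : 0 < Ω ^ (-(α / 2)) := Real.rpow_pos_of_pos hΩ _
  have hI := integral_rpow_mul_exp_neg_mul_rpow hp hq hb
  have hInt : IntegrableOn
      (fun y => y ^ (δ + α * μ / 2 - 1) * Real.exp (-Ω ^ (-(α / 2)) * y ^ (α / 2)))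
      (Set.Ioi 0) := by
    -- A non-integrable function has integral `0` by default, but the Gamma formula `hI` gives a
    -- positive value.
    by_contra hn
    rw [integral_undef hn] at hI
    have : 0 < Real.Gamma ((δ + α * μ / 2 - 1 + 1) / (α / 2)) :=
      Real.Gamma_pos_of_pos (div_pos (by linarith) hp)
    have : 0 < (Ω ^ (-(α / 2))) ^ (-(δ + α * μ / 2 - 1 + 1) / (α / 2)) * (1 / (α / 2)) *
      Real.Gamma ((δ + α * μ / 2 - 1 + 1) / (α / 2)) := by positivity
    exact this.ne hI
  rw [← Measure.restrict_eq_self_of_ae_mem (s := Set.Ioi 0) (ae_pos_alphaMuMeasure α μ Ω),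
    alphaMuMeasure, restrict_withDensity measurableSet_Ioi,
    lintegral_withDensity_eq_lintegral_mul _ (measurable_alphaMuPDF α μ Ω).ennreal_ofReal
      (by fun_prop)]
  have hc : 0 ≤ α / (2 * Ω ^ (α * μ / 2) * Real.Gamma μ) := by positivity
  rw [setLIntegral_congr_fun measurableSet_Ioi (g := fun y =>
    ENNReal.ofReal (α / (2 * Ω ^ (α * μ / 2) * Real.Gamma μ) *
      (y ^ (δ + α * μ / 2 - 1) * Real.exp (-Ω ^ (-(α / 2)) * y ^ (α / 2)))))]
  · rw [← ofReal_integral_eq_lintegral_ofReal (hInt.const_mul _), integral_const_mul, hI]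
    · congr 1
      have e1 : (δ + α * μ / 2 - 1 + 1) / (α / 2) = μ + 2 * δ / α := by field_simp; ring
      have e2 : (Ω ^ (-(α / 2))) ^ (-(δ + α * μ / 2 - 1 + 1) / (α / 2)) =
          Ω ^ δ * Ω ^ (α * μ / 2) := by
        rw [← Real.rpow_mul hΩ.le, ← Real.rpow_add hΩ]
        congr 1
        field_simp
        ring
      have := Real.rpow_pos_of_pos hΩ (α * μ / 2)
      rw [e1, e2]
      field_simp
    · refine (ae_restrict_mem measurableSet_Ioi).mono fun y hy => ?_
      have : 0 < y := hy
      simp only [Pi.zero_apply]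
      positivity
  · intro y hy
    have hy' : 0 < y := hy
    have h0 : 0 ≤ alphaMuPDF α μ Ω y := by
      rw [alphaMuPDF, if_pos hy']
      positivity
    simp only [Pi.mul_apply]
    rw [← ENNReal.ofReal_mul h0, alphaMuPDF_mul_rpow hΩ δ hy']

/-! ### Intensity of the path-loss process -/

lemma volume_norm_rpow_le {d : ℕ} (hd : 1 ≤ d) {υ s : ℝ} (hυ : 0 < υ) (hs : 0 ≤ s) :
    volume {x : EuclideanSpace ℝ (Fin d) | ‖x‖ ^ υ ≤ s} =
      ENNReal.ofReal (unitBallVolume d * s ^ ((d : ℝ) / υ)) := by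
  have : Nonempty (Fin d) := ⟨⟨0, hd⟩⟩
  have hset : {x : EuclideanSpace ℝ (Fin d) | ‖x‖ ^ υ ≤ s} =
      Metric.closedBall 0 (s ^ υ⁻¹) := by
    ext x
    simp [Real.le_rpow_inv_iff_of_pos (norm_nonneg x) hs hυ]
  rw [hset, EuclideanSpace.volume_closedBall, ← ENNReal.ofReal_pow (by positivity),
    ← ENNReal.ofReal_mul (by positivity), Fintype.card_fin, mul_comm]
  congr 2
  · rw [unitBallVolume, Real.sqrt_eq_rpow, ← Real.rpow_mul_natCast Real.pi_pos.le, add_comm]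
    congr 2
    ring
  · rw [← Real.rpow_mul_natCast hs]
    congr 1
    field_simp

/-- Half-lines form a π-system exhausting `ℝ` with finite mass; those with `t ≤ 0` are null for both
measures. -/
lemma Measure.ext_of_Iic_of_nonneg {μ ν : Measure ℝ} (h0 : μ (Set.Iic 0) = 0)
    (hfin : ∀ t, 0 ≤ t → μ (Set.Iic t) ≠ ∞)
    (h : ∀ t, 0 ≤ t → μ (Set.Iic t) = ν (Set.Iic t)) : μ = ν := by
  refine Measure.ext_of_generateFrom_of_iUnion (Set.range Set.Iic) (fun n : ℕ => Set.Iic (n : ℝ))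
    ((BorelSpace.measurable_eq (α := ℝ)).trans (borel_eq_generateFrom_Iic ℝ)) isPiSystem_Iic ?_
    (fun n => ⟨n, rfl⟩) (fun n => hfin n n.cast_nonneg) ?_
  · exact Set.iUnion_eq_univ_iff.2 fun x => exists_nat_ge x
  · rintro _ ⟨t, rfl⟩
    rcases le_total 0 t with ht | ht
    · exact h t ht
    · rw [measure_mono_null (Set.Iic_subset_Iic.2 ht) h0,
        measure_mono_null (Set.Iic_subset_Iic.2 ht) (h 0 le_rfl ▸ h0)]

lemma halfLineIntensity_rpow_Iic {A δ t : ℝ} (hA : 0 ≤ A) (hδ : 0 < δ) (ht : 0 ≤ t) :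
    halfLineIntensity (fun x => A * x ^ (δ - 1)) (Set.Iic t) =
      ENNReal.ofReal (A / δ * t ^ δ) := by
  have hInt : IntervalIntegrable (fun x : ℝ => A * x ^ (δ - 1)) volume 0 t :=
    (intervalIntegral.intervalIntegrable_rpow' (by linarith)).const_mul _
  rw [halfLineIntensity, withDensity_apply _ measurableSet_Iic,
    Measure.restrict_restrict measurableSet_Iic, Set.inter_comm, Set.Ioi_inter_Iic,
    ← ofReal_integral_eq_lintegral_ofReal
      ((intervalIntegrable_iff_integrableOn_Ioc_of_le ht).1 hInt),
    ← intervalIntegral.integral_of_le ht, intervalIntegral.integral_const_mul,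
    integral_rpow (Or.inl (by linarith)), sub_add_cancel, Real.zero_rpow hδ.ne']
  · congr 1
    ring
  · refine (ae_restrict_mem measurableSet_Ioc).mono fun x hx => ?_
    have : 0 < x := hx.1
    simp only [Pi.zero_apply]
    positivity

/-- The intensity measure of the path-loss process with `α`-`μ` fading. -/
lemma map_pathLoss_eq_halfLineIntensity {d : ℕ} (hd : 1 ≤ d) {lam υ δ α μ Ω : ℝ}
    (hlam : 0 < lam) (hυ : 0 < υ) (hδ : δ = (d : ℝ) / υ) (hα : 0 < α) (hμ : 0 < μ) (hΩ : 0 < Ω)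
    [SFinite (alphaMuMeasure α μ Ω)] :
    ((ENNReal.ofReal lam • (volume : Measure (EuclideanSpace ℝ (Fin d)))).prod
      (alphaMuMeasure α μ Ω)).map (fun p => ‖p.1‖ ^ υ / p.2) =
      halfLineIntensity (fun x => intensityCoeff d lam δ α μ Ω * x ^ (δ - 1)) := by
  have hδ0 : 0 < δ := by
    have : (0 : ℝ) < d := by exact_mod_cast hd
    rw [hδ]; positivity
  have hV : 0 ≤ unitBallVolume d := by
    unfold unitBallVolume
    have := Real.Gamma_pos_of_pos (show (0 : ℝ) < 1 + d / 2 by positivity)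
    positivity
  have hΓ := Real.Gamma_pos_of_pos hμ
  have hΓ' := Real.Gamma_pos_of_pos (show 0 < μ + 2 * δ / α by positivity)
  have hA : 0 ≤ intensityCoeff d lam δ α μ Ω := by
    unfold intensityCoeff
    positivity
  have hφ : Measurable fun p : EuclideanSpace ℝ (Fin d) × ℝ => ‖p.1‖ ^ υ / p.2 := by fun_prop
  have key (t : ℝ) (ht : 0 ≤ t) :
      ((ENNReal.ofReal lam • (volume : Measure (EuclideanSpace ℝ (Fin d)))).prod
        (alphaMuMeasure α μ Ω)).map (fun p => ‖p.1‖ ^ υ / p.2) (Set.Iic t) =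
        ENNReal.ofReal (intensityCoeff d lam δ α μ Ω / δ * t ^ δ) := by
    rw [Measure.map_apply hφ measurableSet_Iic,
      Measure.prod_apply_symm (hφ measurableSet_Iic)]
    -- Only for `y > 0` does clearing the denominator turn the slice into a ball; other gains have
    -- probability zero.
    have hae : ∀ᵐ y ∂(alphaMuMeasure α μ Ω),
        (ENNReal.ofReal lam • (volume : Measure (EuclideanSpace ℝ (Fin d))))
          ((fun x => (x, y)) ⁻¹' ((fun p => ‖p.1‖ ^ υ / p.2) ⁻¹' Set.Iic t)) =
        ENNReal.ofReal (lam * unitBallVolume d * t ^ δ) * ENNReal.ofReal (y ^ δ) := by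
      filter_upwards [ae_pos_alphaMuMeasure α μ Ω] with y hy
      have hset : (fun x : EuclideanSpace ℝ (Fin d) => (x, y)) ⁻¹'
          ((fun p => ‖p.1‖ ^ υ / p.2) ⁻¹' Set.Iic t) = {x | ‖x‖ ^ υ ≤ t * y} := by
        ext x
        simp [div_le_iff₀ hy]
      rw [hset, Measure.smul_apply, volume_norm_rpow_le hd hυ (by positivity), smul_eq_mul,
        ← hδ, ← ENNReal.ofReal_mul hlam.le, ← ENNReal.ofReal_mul (by positivity),
        Real.mul_rpow ht hy.le]
      congr 1
      ring
    rw [lintegral_congr_ae hae, lintegral_const_mul _ (by fun_prop),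
      lintegral_rpow_alphaMuMeasure hα hμ hΩ hδ0, ← ENNReal.ofReal_mul (by positivity),
      intensityCoeff]
    congr 1
    field_simp
  refine Measure.ext_of_Iic_of_nonneg ?_ ?_ ?_
  · rw [key 0 le_rfl, Real.zero_rpow hδ0.ne']
    simp
  · intro t ht
    rw [key t ht]
    exact ENNReal.ofReal_ne_top
  · intro t ht
    rw [key t ht, halfLineIntensity_rpow_Iic hA hδ0 ht]

theorem lemma2 {S : Type*} [MeasurableSpace S] (P : Measure S) [IsProbabilityMeasure P]
    (d : ℕ) (hd : 1 ≤ d)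
    (lam υ δ α μ Ω : ℝ) (hlam : 0 < lam) (hυ : 0 < υ) (hδ : δ = (d : ℝ) / υ)
    (hα : 0 < α) (hμ : 0 < μ) (hΩ : 0 < Ω)
    -- the locations of the receivers: a homogeneous Poisson point process with density `lam`
    (X : ℕ → S → EuclideanSpace ℝ (Fin d)) (hX : ∀ n, Measurable (X n))
    (hPPP : IsPoissonPointProcess (pointProcess X)
      (ENNReal.ofReal lam • (volume : Measure (EuclideanSpace ℝ (Fin d)))) P)
    -- the power gains: i.i.d. with the `α`-`μ` distribution, independent of the locations
    (g : ℕ → S → ℝ) (hg : ∀ n, Measurable (g n))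
    (hg_law : ∀ n, P.map (g n) = alphaMuMeasure α μ Ω)
    (hg_indep : iIndepFun g P)
    (hXg : IndepFun (fun ω n => X n ω) (fun ω n => g n ω) P) :
    IsPoissonPointProcess (pointProcess (fun n ω => ‖X n ω‖ ^ υ / g n ω))
      (halfLineIntensity (fun x => intensityCoeff d lam δ α μ Ω * x ^ (δ - 1))) P := by
  -- Being the law of `g 0`, the measure has mass one without integrating its density.
  have : IsProbabilityMeasure (alphaMuMeasure α μ Ω) :=
    hg_law 0 ▸ Measure.isProbabilityMeasure_map (hg 0).aemeasurable
  rw [← map_pathLoss_eq_halfLineIntensity hd hlam hυ hδ hα hμ hΩ]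
  exact hPPP.marked_map hX hg hg_law hg_indep hXg (φ := fun p => ‖p.1‖ ^ υ / p.2) (by fun_prop)
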